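/- Let $P\colon\mathbb{C}\to\mathbb{C}$ be a complex polynomial. A finite critical point of $P$ is a point $c\in\mathbb{C}$ with $P'(c)=0$, and the finite postcritical points of $P$ are the points $P^k(c)$ with $k\ge 1$ and $c$ a finite critical point, where $P^k$ denotes the $k$-th iterate. Suppose that $P$ has exactly two finite postcritical points and that no finite critical point of $P$ is periodic. Then $P$ is not renormalizable, that is, there do not exist an integer $n\ge 1$, an integer $\delta$ and sets $U,V\subset\mathbb{C}$ such that 1. $(P^n,U,V)$ is a polynomial-like map of degree $\delta$: $U$ and $V$ are Jordan domains (bounded simply connected domains in $\mathbb{C}$ whose boundary is a Jordan curve), $\overline{U}$ is a compact subset of $V$, and $P^n$ restricts to a proper holomorphic map $U\to V$ of degree $\delta\geq 1$, i.e. every point of $V$ has exactly $\delta$ preimages in $U$ counted with multiplicity; 2. the filled Julia set $\mathcal{K}(P^n|U)=\{z\in U : (P^n)^k(z)\in U \text{ for all } k\ge 0\}$ is connected; 3. $2\le\delta<(\deg P)^n$. -/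

import Mathlib

/-- A Jordan domain in the plane: a bounded simply connected domain whose boundary is a Jordan
curve, that is, an injective continuous image of the unit circle. -/
structure IsJordanDomain (U : Set ℂ) : Prop where
  isOpen : IsOpen U
  isSimplyConnected : IsSimplyConnected U
  isBounded : Bornology.IsBounded U
  frontier_eq : ∃ γ : Circle → ℂ, Continuous γ ∧ Function.Injective γ ∧ frontier U = Set.range γ

/-- `(f, U, V)` is a polynomial-like map of degree `d ≥ 1`: `U` and `V` are Jordan domains, the
closure of `U` is a compact subset of `V`, and `f` restricts to a proper holomorphic map `U → V`
of degree `d`, i.e. every point of `V` has exactly `d` preimages in `U`, counted with multiplicity.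
(As `d ≥ 1`, the value `0` that `finsum` takes on infinite supports never meets `degree_eq`.) -/
structure IsPolynomialLike (f : ℂ → ℂ) (U V : Set ℂ) (d : ℕ) : Prop where
  jordan_source : IsJordanDomain U
  jordan_target : IsJordanDomain V
  isCompact_closure : IsCompact (closure U)
  closure_subset : closure U ⊆ V
  holomorphic : DifferentiableOn ℂ f U
  proper : ∃ h : Set.MapsTo f U V, IsProperMap (h.restrict f U V)
  one_le_degree : 1 ≤ d
  degree_eq : ∀ w ∈ V, ∑ᶠ z ∈ U ∩ f ⁻¹' {w}, analyticOrderNatAt (fun x => f x - w) z = d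

/-- The filled Julia set of `f : U → V`: the points of `U` whose whole forward orbit stays
in `U`. -/
def filledJuliaSet (f : ℂ → ℂ) (U : Set ℂ) : Set ℂ :=
  {z | ∀ k : ℕ, f^[k] z ∈ U}

namespace Polynomial

/-- The finite critical points of a complex polynomial. -/
def finiteCriticalPoints (P : Polynomial ℂ) : Set ℂ :=
  {c | P.derivative.eval c = 0}

/-- The finite postcritical points of a complex polynomial: the points `P^k(c)` with `k ≥ 1` and
`c` a finite critical point. -/
def finitePostcriticalSet (P : Polynomial ℂ) : Set ℂ :=
  {w | ∃ k : ℕ, 1 ≤ k ∧ ∃ c ∈ P.finiteCriticalPoints, (fun z => P.eval z)^[k] c = w}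

/-- `P^n : U → V` is a renormalization of `P`: a polynomial-like map of degree `δ` with
`2 ≤ δ < (deg P)^n` whose filled Julia set is connected. -/
def IsRenormalization (P : Polynomial ℂ) (n : ℕ) (U V : Set ℂ) : Prop :=
  ∃ δ : ℕ, IsPolynomialLike (fun z => P.eval z)^[n] U V δ ∧
    IsConnected (filledJuliaSet (fun z => P.eval z)^[n] U) ∧
    2 ≤ δ ∧ δ < P.natDegree ^ n

/-- `P` is renormalizable if some iterate `P^n`, `n ≥ 1`, restricts to a renormalization. -/
def IsRenormalizable (P : Polynomial ℂ) : Prop :=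
  ∃ n : ℕ, 1 ≤ n ∧ ∃ U V : Set ℂ, P.IsRenormalization n U V

end Polynomial

/-!
Suppose that `Q = P^n` restricts to a polynomial-like map `U → V` of degree `δ` with connected
filled Julia set `K` and `2 ≤ δ < deg Q`. All critical values of `Q` lie in the postcritical set of
`P`, which consists of two points and is mapped into itself by `Q`, and no fixed point of `Q` is
critical. Over regular values the degree is the number of points of the fibre, and `U` absorbs each
connected subset of `Q⁻¹(V)` which it meets.

* If both postcritical points lie in `V`, then `U` contains a full regular fibre of `Q`
  (`Polynomial.exists_fiber_subset_of_mem_mem`), so `δ = deg Q`. Topologically, `Q⁻¹(V)` is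
  connected because the complement of a disc in `V` around the critical values is an annulus around
  infinity, whose preimage is connected (`Polynomial.isPreconnected_preimage_eval`) and whose
  fundamental group is generated by a loop in `V`.
* If `V` contains at most one postcritical point `v`, and `v ∈ U`, then `v` is a fixed point of `Q`,
  hence a noncritical preimage of itself. As `V` is simply connected, the monodromy of `Q` over
  `V \ {v}` is generated by a small circle around `v`, which fixes the sheet through `v`; so
  `δ = 1` (`Polynomial.exists_fiber_subsingleton_of_notMem`).
* Otherwise `U` contains no postcritical point. As `U` is simply connected, `Q` has sections over
  `U`, and connectedness of `K` makes `Q` injective on `K`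
  (`Polynomial.injOn_of_isPreconnected_of_mapsTo`), whereas the fibre in `U` of a point of `K` has
  `δ ≥ 2` points, all in `K`.

The position of a Jordan domain in the plane is not controlled directly. Instead, a critical
value is moved by a homeomorphism supported in a connected open set
(`IsPreconnected.exists_homeomorph_apply_eq`) until round discs around the other critical value,
parametrised by the exponential map, can be used. In the second case the critical value outside `V`
has to be moved far away without disturbing a given compact subset of `V`; this is possible by
`not_isBounded_connectedComponentIn_compl`, which rests on the existence of logarithms on `V`.
-/

open Set Metric Topology

/-! ### Topology of the plane -/

/-- A compactly supported homeomorphism moving the centre of a disc to any point of the disc. -/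
theorem exists_homeomorph_ball {y z : ℂ} {r : ℝ} (hz : z ∈ ball y r) :
    ∃ h : ℂ ≃ₜ ℂ, (∀ w ∉ ball y r, h w = w) ∧ h y = z := by
  have hr : 0 < r := pos_of_mem_ball hz
  rw [mem_ball, dist_eq_norm] at hz
  let c : NNReal := ⟨‖z - y‖ / r, by positivity⟩
  have hcv : (c : ℝ) = ‖z - y‖ / r := rfl
  have hc1 : c < 1 := by
    rw [← NNReal.coe_lt_coe]
    exact (div_lt_one hr).2 hz
  let f : ℂ → ℂ := fun w ↦ w + ((max 0 (1 - ‖w - y‖ / r) : ℝ) : ℂ) * (z - y)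
  have hf : ApproximatesLinearOn f
      ((ContinuousLinearEquiv.refl ℂ ℂ : ℂ ≃L[ℂ] ℂ) : ℂ →L[ℂ] ℂ) univ c := by
    rw [ApproximatesLinearOn.approximatesLinearOn_iff_lipschitzOnWith, lipschitzOnWith_iff_norm_sub_le]
    intro u _ w _
    have h1 : |max 0 (1 - ‖u - y‖ / r) - max 0 (1 - ‖w - y‖ / r)| ≤ ‖u - w‖ / r := by
      refine (abs_max_sub_max_le_max _ _ _ _).trans ?_
      have : 1 - ‖u - y‖ / r - (1 - ‖w - y‖ / r) = -((‖u - y‖ - ‖w - y‖) / r) := by ring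
      rw [sub_self, abs_zero, this, abs_neg, abs_div, abs_of_pos hr]
      refine max_le (by positivity) ?_
      gcongr
      simpa using abs_norm_sub_norm_le (u - y) (w - y)
    have h2 : (f - ⇑((ContinuousLinearEquiv.refl ℂ ℂ : ℂ ≃L[ℂ] ℂ) : ℂ →L[ℂ] ℂ)) u -
        (f - ⇑((ContinuousLinearEquiv.refl ℂ ℂ : ℂ ≃L[ℂ] ℂ) : ℂ →L[ℂ] ℂ)) w =
        ((max 0 (1 - ‖u - y‖ / r) - max 0 (1 - ‖w - y‖ / r) : ℝ) : ℂ) * (z - y) := by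
      simp [f]; ring
    rw [h2, norm_mul, Complex.norm_real, Real.norm_eq_abs]
    calc _ ≤ ‖u - w‖ / r * ‖z - y‖ := by gcongr
      _ = c * ‖u - w‖ := by rw [hcv]; ring
  refine ⟨hf.toHomeomorph f (Or.inr ?_), fun w hw ↦ ?_, ?_⟩
  · refine hc1.trans_le ?_
    have : ‖((ContinuousLinearEquiv.refl ℂ ℂ).symm : ℂ →L[ℂ] ℂ)‖₊ = 1 := by
      simp
    rw [this, inv_one]
  · change f w = w
    have : 1 ≤ ‖w - y‖ / r := by
      rw [le_div_iff₀ hr]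
      simpa [dist_eq_norm] using hw
    simp [f, max_eq_left (sub_nonpos.2 this)]
  · change f y = z
    simp [f]

/-- Homogeneity: inside a connected open set, any point can be moved to any other by a
homeomorphism of the plane supported in that set. -/
theorem IsPreconnected.exists_homeomorph_apply_eq {M : Set ℂ} (hM : IsPreconnected M)
    (hMo : IsOpen M) {x y : ℂ} (hx : x ∈ M) (hy : y ∈ M) :
    ∃ h : ℂ ≃ₜ ℂ, (∀ w ∉ M, h w = w) ∧ h x = y := by
  let S : Set ℂ := {z | z ∈ M ∧ ∃ h : ℂ ≃ₜ ℂ, (∀ w ∉ M, h w = w) ∧ h x = z}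
  have hS : IsOpen S := by
    rw [Metric.isOpen_iff]
    rintro z ⟨hz, h, hh, rfl⟩
    obtain ⟨r, hr, hrM⟩ := Metric.isOpen_iff.1 hMo _ hz
    refine ⟨r, hr, fun w hw ↦ ⟨hrM hw, ?_⟩⟩
    obtain ⟨k, hk, hkx⟩ := exists_homeomorph_ball hw
    refine ⟨h.trans k, fun u hu ↦ ?_, hkx⟩
    rw [Homeomorph.trans_apply, hh u hu, hk u fun hu' ↦ hu (hrM hu')]
  suffices M ⊆ S from (this hy).2
  refine hM.subset_of_closure_inter_subset hS
    ⟨x, hx, hx, Homeomorph.refl ℂ, fun _ _ ↦ rfl, rfl⟩ ?_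
  rintro z ⟨hzS, hz⟩
  refine ⟨hz, ?_⟩
  obtain ⟨r, hr, hrM⟩ := Metric.isOpen_iff.1 hMo _ hz
  obtain ⟨w, ⟨-, h, hh, rfl⟩, hw⟩ := Metric.mem_closure_iff.1 hzS r hr
  obtain ⟨k, hk, hkz⟩ := exists_homeomorph_ball (mem_ball'.2 hw)
  refine ⟨h.trans k.symm, fun u hu ↦ ?_, ?_⟩
  · rw [Homeomorph.trans_apply, hh u hu, Homeomorph.symm_apply_eq,
      hk u fun hu' ↦ hu (hrM hu')]
  · rw [Homeomorph.trans_apply, ← hkz, Homeomorph.symm_apply_apply]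

theorem isPreconnected_ball_diff_singleton (x : ℂ) (r : ℝ) :
    IsPreconnected (ball x r \ {x}) := by
  rcases le_or_gt r 0 with hr | hr
  · simpa [ball_eq_empty.2 hr] using isPreconnected_empty
  have : ball x r \ {x} = (fun s ↦ x + Complex.exp s) '' {s | s.re < Real.log r} := by
    ext w
    simp only [mem_sdiff, mem_ball, dist_eq_norm, mem_singleton_iff, mem_image, mem_ofPred_eq]
    constructor
    · rintro ⟨h1, h2⟩
      have h3 : w - x ≠ 0 := sub_ne_zero.2 h2
      refine ⟨Complex.log (w - x), ?_, by rw [Complex.exp_log h3]; ring⟩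
      rw [Complex.log_re]
      exact Real.log_lt_log (norm_pos_iff.2 h3) h1
    · rintro ⟨s, hs, rfl⟩
      simpa [Complex.norm_exp, Complex.exp_ne_zero] using (Real.lt_log_iff_exp_lt hr).1 hs
  rw [this]
  exact (convex_halfSpace_re_lt _).isPreconnected.image _ (by fun_prop)

theorem IsPreconnected.diff_singleton {U : Set ℂ} (hU : IsPreconnected U) (hUo : IsOpen U)
    (x : ℂ) : IsPreconnected (U \ {x}) := by
  by_cases hx : x ∈ U
  swap
  · rwa [sdiff_singleton_eq_self hx]
  obtain ⟨r, hr, hrU⟩ := Metric.isOpen_iff.1 hUo x hx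
  have key : ∀ A B : Set ℂ, IsOpen A → IsOpen B → U \ {x} ⊆ A ∪ B → U \ {x} ∩ (A ∩ B) = ∅ →
      ball x r \ {x} ⊆ A → U \ {x} ⊆ A ∨ U \ {x} ⊆ B := by
    intro A B hA hB hAB hd hb
    have hd' : ∀ z ∈ U, z ≠ x → z ∈ A → z ∈ B → False := fun z hz hzx h1 h2 ↦
      (hd.subset ⟨⟨hz, hzx⟩, h1, h2⟩ : z ∈ (∅ : Set ℂ))
    have hcov : U ⊆ (A ∪ ball x r) ∪ B \ {x} := by
      intro z hz
      by_cases hzx : z = x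
      · exact Or.inl (Or.inr (hzx ▸ mem_ball_self hr))
      · exact (hAB ⟨hz, hzx⟩).elim (fun h ↦ Or.inl (Or.inl h)) fun h ↦ Or.inr ⟨h, hzx⟩
    have hdis : U ∩ ((A ∪ ball x r) ∩ (B \ {x})) = ∅ := by
      refine eq_empty_of_forall_notMem ?_
      rintro z ⟨hz, h1 | h1, h2, hzx⟩
      · exact hd' z hz hzx h1 h2
      · exact hd' z hz hzx (hb ⟨h1, hzx⟩) h2
    rcases isPreconnected_iff_subset_of_disjoint.1 hU (A ∪ ball x r) (B \ {x})
      (hA.union isOpen_ball) (hB.sdiff isClosed_singleton) hcov hdis with h | h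
    · exact Or.inl fun z hz ↦ (h hz.1).elim id fun h' ↦ hb ⟨h', hz.2⟩
    · exact Or.inr fun z hz ↦ (h hz.1).1
  rw [isPreconnected_iff_subset_of_disjoint]
  intro A B hA hB hAB hd
  have hsub : ball x r \ {x} ⊆ U \ {x} := sdiff_subset_sdiff_left hrU
  rcases isPreconnected_iff_subset_of_disjoint.1 (isPreconnected_ball_diff_singleton x r) A B hA hB
    (hsub.trans hAB) (subset_empty_iff.1 (hd ▸ inter_subset_inter_left _ hsub)) with h | h
  · exact key A B hA hB hAB hd h
  · exact (key B A hB hA (union_comm A B ▸ hAB) (inter_comm A B ▸ hd) h).symm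

/-- Removing finitely many points does not disconnect an open subset of the plane. -/
theorem IsPreconnected.diff_finite {U F : Set ℂ} (hU : IsPreconnected U) (hUo : IsOpen U)
    (hF : F.Finite) : IsPreconnected (U \ F) := by
  induction F, hF using Set.Finite.induction_on with
  | empty => simpa
  | @insert x F _ hF ih =>
    rw [← union_singleton, ← sdiff_sdiff]
    exact ih.diff_singleton (hUo.sdiff hF.isClosed) x

/-- A continuous nowhere vanishing function on the plane cannot coincide with `z ↦ z - b` outside
a disc: it has a continuous logarithm, while `z - b` has none on large circles. -/
theorem exists_ne_sub_of_continuous_of_ne_zero {G : ℂ → ℂ} (hG : Continuous G)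
    (hG0 : ∀ z, G z ≠ 0) (b : ℂ) (R : ℝ) : ∃ z, R < ‖z - b‖ ∧ G z ≠ z - b := by
  by_contra! H
  have hsc : IsSimplyConnected (univ : Set ℂ) := by
    have := convex_univ (E := ℂ) (𝕜 := ℝ) |>.contractibleSpace ⟨0, trivial⟩
    exact SimplyConnectedSpace.ofContractible _
  obtain ⟨L, hLc, hL⟩ := Complex.exists_continuousOn_eqOn_exp_comp hsc isOpen_univ hG.continuousOn
    (by simpa using hG0)
  rw [continuousOn_univ] at hLc
  obtain ⟨s, hs⟩ : ∃ s : ℝ, R < Real.exp s := by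
    obtain ⟨s, hs⟩ := (Real.tendsto_exp_atTop.eventually_gt_atTop R).exists
    exact ⟨s, hs⟩
  let c : ℝ → ℂ := fun t ↦ b + Complex.exp (s + t * Complex.I)
  have hc : Continuous c := by fun_prop
  have hexp : ∀ t, Complex.exp (L (c t)) = Complex.exp (s + t * Complex.I) := by
    intro t
    have h1 : Complex.exp (L (c t)) = G (c t) := hL (mem_univ _)
    rw [h1, H _ (by simpa [c, Complex.norm_exp] using hs)]
    simp [c]
  let D : ℝ → ℂ := fun t ↦ L (c t) - (s + t * Complex.I)
  have hD : ∀ t u, D t = D u := by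
    have hDc : Continuous D := by fun_prop
    refine fun t u ↦ Complex.isCoveringMap_exp.const_of_comp hDc (fun t u ↦ ?_) t u
    simp only [D, Complex.exp_sub, hexp]
    rw [Subtype.mk.injEq, div_self (Complex.exp_ne_zero _), div_self (Complex.exp_ne_zero _)]
  have h0 := hD 0 (2 * Real.pi)
  have hcc : c 0 = c (2 * Real.pi) := by
    simp only [c]
    push_cast
    rw [Complex.exp_add _ (2 * Real.pi * Complex.I), Complex.exp_two_pi_mul_I]
    simp
  simp only [D, hcc] at h0
  have : (Real.pi : ℂ) ≠ 0 := by exact_mod_cast Real.pi_ne_zero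
  simp [this] at h0

/-- A point outside a simply connected open set `V` lies in an unbounded component of the
complement of every compact subset of `V`. -/
theorem not_isBounded_connectedComponentIn_compl {V L : Set ℂ} (hVo : IsOpen V)
    (hV : IsSimplyConnected V) (hL : IsCompact L) (hLV : L ⊆ V) {b : ℂ} (hb : b ∉ V) :
    ¬ Bornology.IsBounded (connectedComponentIn Lᶜ b) := by
  intro hbdd
  set N := connectedComponentIn Lᶜ b
  have hbL : b ∈ Lᶜ := fun h ↦ hb (hLV h)
  have hbN : b ∈ N := mem_connectedComponentIn hbL
  have hLo : IsOpen Lᶜ := hL.isClosed.isOpen_compl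
  have hNo : IsOpen N := hLo.connectedComponentIn
  have hfr : frontier N ⊆ L := by
    intro x hx
    by_contra hxL
    have hxo : IsOpen (connectedComponentIn Lᶜ x) := hLo.connectedComponentIn
    obtain ⟨y, hy1, hy2⟩ := mem_closure_iff.1 (frontier_subset_closure hx) _ hxo
      (mem_connectedComponentIn hxL)
    have : connectedComponentIn Lᶜ x = N :=
      (connectedComponentIn_eq hy1).trans (connectedComponentIn_eq hy2).symm
    have hxN : x ∈ N := this ▸ mem_connectedComponentIn hxL
    rw [hNo.frontier_eq] at hx
    exact hx.2 hxN
  obtain ⟨l, hlc, hl⟩ := Complex.exists_continuousOn_eqOn_exp_comp hV hVo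
    (g := fun z ↦ z - b) (by fun_prop) (by
      rintro ⟨z, hz, hzb⟩
      exact hb (sub_eq_zero.1 hzb ▸ hz))
  obtain ⟨m, hm⟩ := ContinuousMap.exists_restrict_eq hL.isClosed
    ⟨L.domRestrict l, (hlc.mono hLV).domRestrict⟩
  have hml : ∀ z ∈ L, m z = l z := fun z hz ↦ congr($hm ⟨z, hz⟩)
  classical
  let G : ℂ → ℂ := N.piecewise (fun z ↦ Complex.exp (m z)) (fun z ↦ z - b)
  have hG : Continuous G := by
    refine Continuous.piecewise (fun z hz ↦ ?_) (by fun_prop) (by fun_prop)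
    rw [hml z (hfr hz)]
    exact hl (hLV (hfr hz))
  have hG0 : ∀ z, G z ≠ 0 := by
    intro z
    by_cases hz : z ∈ N
    · simp [G, hz]
    · simpa [G, hz, sub_eq_zero] using fun h : z = b ↦ hz (h ▸ hbN)
  obtain ⟨R, hR⟩ := hbdd.subset_closedBall b
  obtain ⟨z, hz, hzG⟩ := exists_ne_sub_of_continuous_of_ne_zero hG hG0 b R
  have hzN : z ∉ N := fun h ↦ by
    have := hR h
    rw [mem_closedBall, dist_eq_norm] at this
    linarith
  exact hzG (by simp [G, hzN])

/-! ### Lifting through coverings and preimages under polynomials -/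

theorem IsCoveringMapOn.eqOn_of_comp_eqOn {E X A : Type*} [TopologicalSpace E]
    [TopologicalSpace X] [TopologicalSpace A] {q : E → X} {S : Set X} (hq : IsCoveringMapOn q S)
    {s : Set A} (hs : IsPreconnected s) {f g : A → E} (hf : ContinuousOn f s)
    (hg : ContinuousOn g s) (h : s.EqOn (q ∘ f) (q ∘ g)) (hS : ∀ x ∈ s, q (f x) ∈ S)
    {a : A} (ha : a ∈ s) (hfg : f a = g a) : s.EqOn f g := by
  have := isPreconnected_iff_preconnectedSpace.1 hs
  have hS' : ∀ x ∈ s, q (g x) ∈ S := fun x hx ↦ by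
    rw [← show q (f x) = q (g x) from h hx]
    exact hS x hx
  let F : s → q ⁻¹' S := fun x ↦ ⟨f x, hS x x.2⟩
  let G : s → q ⁻¹' S := fun x ↦ ⟨g x, hS' x x.2⟩
  have hFG : F = G := hq.isCoveringMap_restrictPreimage.eq_of_comp_eq
    (hf.domRestrict.subtype_mk _) (hg.domRestrict.subtype_mk _)
    (funext fun x ↦ Subtype.ext (h x.2)) ⟨a, ha⟩ (Subtype.ext hfg)
  exact fun x hx ↦ congr_arg Subtype.val (congr_fun hFG ⟨x, hx⟩)

/-- Lifting through a covering over `S` of a map defined on a simply connected open set. -/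
theorem IsCoveringMapOn.exists_continuousOn_lift {q : ℂ → ℂ} {S : Set ℂ}
    (hq : IsCoveringMapOn q S) {H : Set ℂ} (hHo : IsOpen H) (hH : IsSimplyConnected H)
    {g : ℂ → ℂ} (hg : ContinuousOn g H) (hS : ∀ s ∈ H, g s ∈ S) {s₀ e₀ : ℂ} (hs₀ : s₀ ∈ H)
    (he : q e₀ = g s₀) :
    ∃ ψ : ℂ → ℂ, ContinuousOn ψ H ∧ ψ s₀ = e₀ ∧ ∀ s ∈ H, q (ψ s) = g s := by
  classical
  have := hH.simplyConnectedSpace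
  have := hHo.locallyPathConnectedSpace
  obtain ⟨F, ⟨hF0, hF⟩, -⟩ := hq.existsUnique_continuousMap_lifts
    (⟨H.domRestrict g, hg.domRestrict⟩ : C(H, ℂ)) (a₀ := ⟨s₀, hs₀⟩) he fun a ↦ hS a a.2
  refine ⟨fun s ↦ if h : s ∈ H then F ⟨s, h⟩ else 0, ?_, ?_, fun s hs ↦ ?_⟩
  · rw [continuousOn_iff_continuous_domRestrict]
    convert! F.continuous using 1
    ext s
    simp
  · simpa [hs₀] using hF0
  · simpa [hs] using congr_fun hF ⟨s, hs⟩

theorem Convex.isSimplyConnected {H : Set ℂ} (hH : Convex ℝ H) (hne : H.Nonempty) :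
    IsSimplyConnected H := by
  have := hH.contractibleSpace hne
  exact SimplyConnectedSpace.ofContractible _

/-- A path avoiding `0` has a continuous logarithm with prescribed starting value. -/
theorem exists_continuous_exp_eq {φ : unitInterval → ℂ} (hφ : Continuous φ) (h0 : ∀ t, φ t ≠ 0)
    {s₀ : ℂ} (hs : Complex.exp s₀ = φ 0) :
    ∃ s : unitInterval → ℂ, Continuous s ∧ s 0 = s₀ ∧ ∀ t, Complex.exp (s t) = φ t := by
  obtain ⟨s, hs1, hs2⟩ := Complex.isCoveringMap_exp.exists_path_lifts
    ⟨fun t ↦ ⟨φ t, h0 t⟩, by fun_prop⟩ s₀ (Subtype.ext hs.symm)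
  exact ⟨s, s.continuous, hs2, fun t ↦ congr_arg Subtype.val (congr_fun hs1 t)⟩

/-- Monodromy along exponential coordinates: let `k` be a homeomorphism of the plane such that
`s ↦ k (v + exp s)` sends the convex set `H` into the set over which `q` is a covering. If a path
`τ` is projected by `q` into the image of this map, its end point is the value at a logarithm of
the end point of the lift of this map that passes through the starting point of `τ`. -/
theorem IsCoveringMapOn.exists_exp_eq_and_lift_eq {q : ℂ → ℂ} (hqc : Continuous q) {S : Set ℂ}
    (hq : IsCoveringMapOn q S) {v : ℂ} {k : ℂ ≃ₜ ℂ} {H : Set ℂ}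
    (hHS : ∀ s ∈ H, k (v + Complex.exp s) ∈ S) {ψ : ℂ → ℂ} (hψc : ContinuousOn ψ H)
    (hψ : ∀ s ∈ H, q (ψ s) = k (v + Complex.exp s)) {x y s₀ : ℂ} (τ : Path x y)
    (hτ : ∀ t, ∀ s, Complex.exp s = k.symm (q (τ t)) - v → s ∈ H)
    (hv : ∀ t, k.symm (q (τ t)) ≠ v) (hs₀ : Complex.exp s₀ = k.symm (q x) - v) (hx : ψ s₀ = x) :
    ∃ s₁, Complex.exp s₁ = k.symm (q y) - v ∧ ψ s₁ = y := by
  obtain ⟨s, hsc, hs0, hs⟩ := exists_continuous_exp_eq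
    (φ := fun t ↦ k.symm (q (τ t)) - v) (by fun_prop) (fun t ↦ sub_ne_zero.2 (hv t))
    (s₀ := s₀) (by simpa using hs₀)
  have hsH : ∀ t, s t ∈ H := fun t ↦ hτ t _ (hs t)
  have hk : ∀ t, k (v + Complex.exp (s t)) = q (τ t) := fun t ↦ by simp [hs t]
  have key : EqOn (fun t ↦ ψ (s t)) τ univ := by
    refine hq.eqOn_of_comp_eqOn isPreconnected_univ
      (hψc.comp_continuous hsc hsH).continuousOn τ.continuous.continuousOn (fun t _ ↦ ?_)
      (fun t _ ↦ ?_) (mem_univ 0) ?_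
    · simp only [Function.comp_apply, hψ _ (hsH t), hk]
    · rw [hψ _ (hsH t)]
      exact hHS _ (hsH t)
    · simp [hs0, hx]
  refine ⟨s 1, by simpa using hs 1, by simpa using key (mem_univ 1)⟩

/-- The preimage under a nonconstant polynomial of a connected neighbourhood of infinity is
connected: every bounded component would be mapped onto the whole neighbourhood. -/
theorem Polynomial.isPreconnected_preimage_eval {Q : Polynomial ℂ} (hQ : Q.natDegree ≠ 0)
    {O : Set ℂ} (hO : IsOpen O) (hOc : IsPreconnected O) (hOb : Bornology.IsBounded Oᶜ) :
    IsPreconnected ((fun z ↦ Q.eval z) ⁻¹' O) := by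
  have hprop : IsProperMap (fun z ↦ Q.eval z) :=
    Q.isProperMap_eval (natDegree_pos_iff_degree_pos.1 (Nat.pos_of_ne_zero hQ))
  have hopen : IsOpenMap (fun z ↦ Q.eval z) := (Q.isOpenQuotientMap_eval hQ).isOpenMap
  have hcont : Continuous (fun z ↦ Q.eval z) := Q.continuous
  set W := (fun z ↦ Q.eval z) ⁻¹' O
  have hW : IsOpen W := hO.preimage hcont
  obtain ⟨R, hR0, hR⟩ : ∃ R : ℝ, 0 < R ∧ {z : ℂ | R < ‖z‖} ⊆ W := by
    have hb : Bornology.IsBounded Wᶜ :=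
      (hprop.isCompact_preimage hOb.isCompact_closure).isBounded.subset
        (fun z hz ↦ subset_closure hz)
    obtain ⟨R, hR0, hR⟩ := hb.subset_closedBall_lt 0 0
    refine ⟨R, hR0, fun z hz ↦ ?_⟩
    by_contra hzW
    exact absurd (mem_closedBall_zero_iff.1 (hR hzW)) (not_le.2 hz)
  have hE : IsPreconnected {z : ℂ | R < ‖z‖} := by
    have : {z : ℂ | R < ‖z‖} = Complex.exp '' {s | Real.log R < s.re} := by
      ext w
      constructor
      · intro h
        have h0 : w ≠ 0 := norm_pos_iff.1 (hR0.trans h)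
        refine ⟨Complex.log w, ?_, Complex.exp_log h0⟩
        rw [mem_ofPred_eq, Complex.log_re]
        exact Real.log_lt_log hR0 h
      · rintro ⟨s, hs, rfl⟩
        simpa [Complex.norm_exp] using (Real.log_lt_iff_lt_exp hR0).1 hs
    rw [this]
    exact (convex_halfSpace_re_gt _).isPreconnected.image _ (by fun_prop)
  have key : ∀ A B : Set ℂ, IsOpen A → IsOpen B → W ⊆ A ∪ B → W ∩ (A ∩ B) = ∅ →
      {z : ℂ | R < ‖z‖} ⊆ A → W ⊆ A := by
    intro A B hA hB hAB hd hEA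
    have hdis : ∀ z ∈ W, z ∈ A → z ∈ B → False := fun z h1 h2 h3 ↦
      (hd.subset ⟨h1, h2, h3⟩ : z ∈ (∅ : Set ℂ))
    suffices hemp : ¬ (W ∩ B).Nonempty by
      intro z hz
      exact (hAB hz).elim id fun h ↦ (hemp ⟨z, hz, h⟩).elim
    rintro ⟨z₀, hz₀, hz₀B⟩
    have hWB : W ∩ B ⊆ closedBall 0 R := by
      rintro z ⟨hz, hzB⟩
      rw [mem_closedBall_zero_iff]
      by_contra! h
      exact hdis z hz (hEA h) hzB
    have hbdd : Bornology.IsBounded (W ∩ B) := isBounded_closedBall.subset hWB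
    have hOsub : O ⊆ (fun z ↦ Q.eval z) '' (W ∩ B) := by
      refine hOc.subset_of_closure_inter_subset (hopen _ (hW.inter hB))
        ⟨_, hz₀, z₀, ⟨hz₀, hz₀B⟩, rfl⟩ ?_
      rintro w ⟨hw, hwO⟩
      have hcl : IsClosed ((fun z ↦ Q.eval z) '' closure (W ∩ B)) :=
        (hbdd.isCompact_closure.image hcont).isClosed
      obtain ⟨z, hz, rfl⟩ := closure_minimal (image_mono subset_closure) hcl hw
      refine ⟨z, ⟨hwO, ?_⟩, rfl⟩
      refine (hAB hwO).elim (fun hzA ↦ ?_) id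
      obtain ⟨y, ⟨-, hyA⟩, hyW, hyB⟩ := mem_closure_iff.1 hz _ (hW.inter hA) ⟨hwO, hzA⟩
      exact (hdis y hyW hyA hyB).elim
    have hObdd : Bornology.IsBounded O :=
      (hbdd.isCompact_closure.image hcont).isBounded.subset
        (hOsub.trans (image_mono subset_closure))
    refine NormedSpace.unbounded_univ ℝ ℂ ?_
    rw [← union_compl_self O]
    exact hObdd.union hOb
  rw [isPreconnected_iff_subset_of_disjoint]
  intro A B hA hB hAB hd
  rcases isPreconnected_iff_subset_of_disjoint.1 hE A B hA hB (hR.trans hAB)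
    (subset_empty_iff.1 (hd ▸ inter_subset_inter_left _ hR)) with h | h
  · exact Or.inl (key A B hA hB hAB hd h)
  · exact Or.inr (key B A hB hA (union_comm A B ▸ hAB) (inter_comm A B ▸ hd) h)

/-! ### Monodromy of polynomials with at most two critical values -/

namespace Polynomial

theorem isCoveringMapOn_eval_compl_pair {Q : Polynomial ℂ} {a b : ℂ}
    (hcrit : ∀ z, Q.derivative.eval z = 0 → Q.eval z = a ∨ Q.eval z = b) :
    IsCoveringMapOn (fun z ↦ Q.eval z) {a, b}ᶜ := by
  refine Q.isCoveringMapOn_eval.mono (compl_subset_compl.2 ?_)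
  rintro _ ⟨z, hz, rfl⟩
  exact hcrit z hz

/-- If a connected open set `V` contains all critical values of `Q` (at most two), then a subset
`U` of the preimage of `V` that absorbs every connected subset of that preimage which it meets
contains a full regular fibre as soon as it meets it: the two critical values can be brought into
one disc by a homeomorphism `h` supported in `V`, the preimage of the exterior of that disc is
connected, and monodromy in the exterior is carried by a circle contained in `V`. -/
theorem exists_fiber_subset_of_mem_mem {Q : Polynomial ℂ} (hQ : Q.natDegree ≠ 0) {a b : ℂ}
    (hcrit : ∀ z, Q.derivative.eval z = 0 → Q.eval z = a ∨ Q.eval z = b) {U V : Set ℂ}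
    (hV : IsOpen V) (hVc : IsPreconnected V) (ha : a ∈ V) (hb : b ∈ V) (hab : a ≠ b)
    (hU : ∀ T : Set ℂ, IsPreconnected T → (∀ z ∈ T, Q.eval z ∈ V) → (T ∩ U).Nonempty → T ⊆ U) :
    ∃ p ∈ V, p ≠ a ∧ p ≠ b ∧ ∀ u ∈ U, Q.eval u = p → ∀ u', Q.eval u' = p → u' ∈ U := by
  have hcov := isCoveringMapOn_eval_compl_pair hcrit
  obtain ⟨r, hr, hrV⟩ := Metric.nhds_basis_closedBall.mem_iff.1 (hV.mem_nhds ha)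
  have hnorm : ∀ t : ℝ, 0 ≤ t → ‖(t : ℂ)‖ = t := fun t ht ↦ by
    rw [Complex.norm_real, Real.norm_of_nonneg ht]
  have hr4 : ‖((r / 4 : ℝ) : ℂ)‖ = r / 4 := hnorm _ (by positivity)
  have hr1 : ‖(r : ℂ)‖ = r := hnorm _ hr.le
  obtain ⟨h, hh, hhb⟩ := (hVc.diff_singleton hV a).exists_homeomorph_apply_eq
    (hV.sdiff isClosed_singleton) (x := b) (y := a + (r / 4 : ℝ)) ⟨hb, hab.symm⟩
    ⟨hrV (by rw [mem_closedBall, dist_eq_norm, add_sub_cancel_left, hr4]; linarith), by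
      intro h0
      have : ((r / 4 : ℝ) : ℂ) = 0 := by simpa using h0
      rw [this, norm_zero] at hr4
      linarith⟩
  have hha : h a = a := hh a fun h' ↦ h'.2 rfl
  have hsV : ∀ w ∈ V, h.symm w ∈ V := by
    intro w hw
    by_contra hw'
    have := hh _ fun h' ↦ hw' h'.1
    rw [Homeomorph.apply_symm_apply] at this
    exact hw' (this ▸ hw)
  have hpV : h.symm (a + r) ∈ V :=
    hsV _ (hrV (by rw [mem_closedBall, dist_eq_norm, add_sub_cancel_left, hr1]))
  have hne : ∀ x : ℂ, r / 2 < ‖x‖ → h.symm (a + x) ∈ ({a, b}ᶜ : Set ℂ) := by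
    intro x hx
    rintro (h0 | h0)
    · rw [Homeomorph.symm_apply_eq, hha] at h0
      have : x = 0 := by simpa using h0
      rw [this, norm_zero] at hx
      linarith
    · rw [mem_singleton_iff, Homeomorph.symm_apply_eq, hhb, add_right_inj] at h0
      rw [h0, hr4] at hx
      linarith
  have hpS : h.symm (a + r) ∈ ({a, b}ᶜ : Set ℂ) := hne r (by rw [hr1]; linarith)
  simp only [mem_compl_iff, mem_insert_iff, mem_singleton_iff, not_or] at hpS
  refine ⟨_, hpV, hpS.1, hpS.2, fun u hu hup u' hup' ↦ ?_⟩
  -- The half plane `H` parametrises the exterior of the disc of radius `r / 2`.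
  let H : Set ℂ := {s | Real.log (r / 2) < s.re}
  have hHn : ∀ s, s ∈ H ↔ r / 2 < ‖Complex.exp s‖ := fun s ↦ by
    rw [Complex.norm_exp]
    exact Real.log_lt_iff_lt_exp (by positivity)
  have hHc : Convex ℝ H := convex_halfSpace_re_gt _
  have hHo : IsOpen H := isOpen_lt continuous_const Complex.continuous_re
  have hHS : ∀ s ∈ H, h.symm (a + Complex.exp s) ∈ ({a, b}ᶜ : Set ℂ) :=
    fun s hs ↦ hne _ ((hHn s).1 hs)
  have hexp : Complex.exp (Real.log r) = r := by
    rw [← Complex.ofReal_exp, Real.exp_log hr]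
  have hs₀ : ((Real.log r : ℝ) : ℂ) ∈ H := by
    rw [hHn, hexp, hr1]; linarith
  obtain ⟨ψ, hψc, hψ0, hψ⟩ := hcov.exists_continuousOn_lift hHo
    (hHc.isSimplyConnected ⟨_, hs₀⟩) (g := fun s ↦ h.symm (a + Complex.exp s))
    (by fun_prop) hHS hs₀ (e₀ := u) (by rw [hexp, hup])
  have hline : ψ '' {s | s.re = Real.log r} ⊆ U := by
    have hsub : {s : ℂ | s.re = Real.log r} ⊆ H := by
      intro s hs
      rw [hHn, Complex.norm_exp, show s.re = Real.log r from hs, Real.exp_log hr]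
      linarith
    refine hU _ ((convex_hyperplane (f := Complex.re) Complex.reLm.isLinear _).isPreconnected.image
      _ (hψc.mono hsub)) ?_ ⟨u, ⟨_, by simp, hψ0⟩, hu⟩
    rintro _ ⟨s, hs, rfl⟩
    rw [hψ s (hsub hs)]
    refine hsV _ (hrV ?_)
    rw [mem_closedBall, dist_eq_norm, add_sub_cancel_left, Complex.norm_exp,
      show s.re = Real.log r from hs, Real.exp_log hr]
  have hO : IsOpen (h ⁻¹' (closedBall a (r / 2))ᶜ) :=
    isClosed_closedBall.isOpen_compl.preimage h.continuous
  have hOc : IsPreconnected (h ⁻¹' (closedBall a (r / 2))ᶜ) := by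
    have : h ⁻¹' (closedBall a (r / 2))ᶜ = (fun s ↦ h.symm (a + Complex.exp s)) '' H := by
      ext w
      simp only [mem_preimage, mem_compl_iff, mem_closedBall, dist_eq_norm, not_le, mem_image]
      constructor
      · intro hw
        have hw0 : h w - a ≠ 0 := norm_pos_iff.1 (lt_trans (by positivity) hw)
        exact ⟨Complex.log (h w - a), by rwa [hHn, Complex.exp_log hw0],
          by rw [Complex.exp_log hw0]; simp⟩
      · rintro ⟨s, hs, rfl⟩
        simpa using (hHn s).1 hs
    rw [this]
    exact hHc.isPreconnected.image _ (by fun_prop)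
  have hOb : Bornology.IsBounded (h ⁻¹' (closedBall a (r / 2))ᶜ)ᶜ := by
    rw [preimage_compl, compl_compl]
    exact (h.isCompact_preimage.2 (isCompact_closedBall a (r / 2))).isBounded
  have hmem : ∀ z, Q.eval z = h.symm (a + r) →
      z ∈ (fun z ↦ Q.eval z) ⁻¹' (h ⁻¹' (closedBall a (r / 2))ᶜ) := by
    intro z hz
    simp only [mem_preimage, hz, Homeomorph.apply_symm_apply, mem_compl_iff, mem_closedBall,
      dist_eq_norm, add_sub_cancel_left, hr1]
    linarith
  obtain ⟨τ, hτ⟩ := ((hO.preimage Q.continuous).isConnected_iff_isPathConnected.1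
    ⟨⟨u, hmem u hup⟩, isPreconnected_preimage_eval hQ hO hOc hOb⟩).joinedIn u (hmem u hup) u'
      (hmem u' hup')
  have hτ' : ∀ t, r / 2 < ‖h (Q.eval (τ t)) - a‖ := fun t ↦ by
    simpa [dist_eq_norm] using hτ t
  obtain ⟨s₁, hs₁, rfl⟩ := hcov.exists_exp_eq_and_lift_eq Q.continuous (k := h.symm) hHS hψc hψ τ
    (fun t s hs ↦ by rw [hHn, hs]; exact hτ' t)
    (fun t h0 ↦ by
      have := hτ' t
      rw [show h (Q.eval (τ t)) = a from h0, sub_self, norm_zero] at this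
      linarith)
    (s₀ := (Real.log r : ℝ)) (by rw [hexp, hup]; simp) hψ0
  refine hline ⟨s₁, ?_, rfl⟩
  rw [hup', Homeomorph.symm_symm, Homeomorph.apply_symm_apply, add_sub_cancel_left] at hs₁
  rw [mem_ofPred_eq, ← Real.log_exp s₁.re, ← Complex.norm_exp, hs₁, hr1]

/-- If a simply connected open set `V` contains only one critical value `v` of `Q`, then on a
connected open set `U` mapped into `V` and containing a noncritical preimage of `v`, the map `Q`
is injective over points close to `v`: a path in `U` between two points of such a fibre is
projected to a loop in a compact set `L ⊆ V`; after pushing the other critical value out of a disc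
containing `L`, the loop is homotopic to a multiple of a small circle around `v`, which lifts to a
closed curve near the noncritical preimage. -/
theorem exists_fiber_subsingleton_of_notMem {Q : Polynomial ℂ} {v b : ℂ}
    (hcrit : ∀ z, Q.derivative.eval z = 0 → Q.eval z = v ∨ Q.eval z = b) {U V : Set ℂ}
    (hQ : Q.natDegree ≠ 0)
    (hV : IsOpen V) (hVs : IsSimplyConnected V) (hb : b ∉ V) (hU : IsOpen U)
    (hUc : IsPreconnected U) (hUV : ∀ z ∈ U, Q.eval z ∈ V) {c : ℂ} (hc : c ∈ U)
    (hcv : Q.eval c = v) (hc' : Q.derivative.eval c ≠ 0) :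
    ∃ p ∈ V, p ≠ v ∧ p ≠ b ∧
      ∀ z₁ ∈ U, ∀ z₂ ∈ U, Q.eval z₁ = p → Q.eval z₂ = p → z₁ = z₂ := by
  have hcov := isCoveringMapOn_eval_compl_pair hcrit
  have hv : v ∈ V := hcv ▸ hUV c hc
  -- A local inverse `e.symm` of `Q` near `v` with values in `U`.
  obtain ⟨e, hce, he⟩ : ∃ e : OpenPartialHomeomorph ℂ ℂ, c ∈ e.source ∧ ⇑e = fun z ↦ Q.eval z :=
    ⟨_, ((Q.hasStrictDerivAt c).hasStrictFDerivAt_equiv hc').mem_toOpenPartialHomeomorph_source,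
      by simp⟩
  have hev : e c = v := by rw [he]; exact hcv
  have heO : e.target ∩ e.symm ⁻¹' U ∈ 𝓝 v :=
    (e.isOpen_inter_preimage_symm hU).mem_nhds ⟨hev ▸ e.map_source hce, by
      rw [mem_preimage, ← hev, e.left_inv hce]; exact hc⟩
  obtain ⟨r, hr, hrV⟩ := Metric.nhds_basis_closedBall.mem_iff.1
    (Filter.inter_mem (hV.mem_nhds hv) heO)
  have hσ : ∀ w ∈ closedBall v r, Q.eval (e.symm w) = w := fun w hw ↦ by
    simpa [he] using e.right_inv (hrV hw).2.1
  have hr1 : ‖(r : ℂ)‖ = r := by rw [Complex.norm_real, Real.norm_of_nonneg hr.le]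
  have hpr : v + r ∈ closedBall v r := by
    rw [mem_closedBall, dist_eq_norm, add_sub_cancel_left, hr1]
  have hr0 : (r : ℂ) ≠ 0 := by exact_mod_cast hr.ne'
  have hpb : v + r ≠ b := fun h ↦ hb (h ▸ (hrV hpr).1)
  suffices key : ∀ z ∈ U, Q.eval z = v + r → z = e.symm (v + r) from
    ⟨v + r, (hrV hpr).1, by simpa using hr0, hpb,
      fun z₁ h₁ z₂ h₂ h₁' h₂' ↦ (key z₁ h₁ h₁').trans (key z₂ h₂ h₂').symm⟩
  intro z hz hzp
  have hfin : ((fun z ↦ Q.eval z) ⁻¹' {v}).Finite := by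
    rw [preimage_eval_singleton (by rintro rfl; simp at hQ)]
    exact rootSet_finite ..
  have hmem : ∀ y ∈ U, Q.eval y = v + r → y ∈ U \ (fun z ↦ Q.eval z) ⁻¹' {v} :=
    fun y hy hyp ↦ ⟨hy, fun h0 ↦ hr0 (by simpa [hyp] using h0)⟩
  have hxU := hmem _ (hrV hpr).2.2 (hσ _ hpr)
  obtain ⟨τ, hτ⟩ := ((hU.sdiff hfin.isClosed).isConnected_iff_isPathConnected.1
    ⟨⟨_, hxU⟩, hUc.diff_finite hU hfin⟩).joinedIn _ hxU z (hmem z hz hzp)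
  let L : Set ℂ := closedBall v r ∪ range fun t ↦ Q.eval (τ t)
  have hL : IsCompact L :=
    (isCompact_closedBall v r).union (isCompact_range (by fun_prop))
  have hLV : L ⊆ V := by
    rintro w (hw | ⟨t, rfl⟩)
    · exact (hrV hw).1
    · exact hUV _ (hτ t).1
  obtain ⟨R, hR⟩ := hL.isBounded.subset_ball v
  have hbL : b ∈ Lᶜ := fun h ↦ hb (hLV h)
  obtain ⟨b', hb'N, hb'R⟩ : ∃ b' ∈ connectedComponentIn Lᶜ b, R < ‖b' - v‖ := by
    by_contra! hN
    refine not_isBounded_connectedComponentIn_compl hV hVs hL hLV hb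
      (isBounded_closedBall (x := v) (r := R) |>.subset fun w hw ↦ ?_)
    simpa [dist_eq_norm] using hN w hw
  obtain ⟨h, hh, hhb⟩ := isPreconnected_connectedComponentIn.exists_homeomorph_apply_eq
    hL.isClosed.isOpen_compl.connectedComponentIn (mem_connectedComponentIn hbL) hb'N
  have hhL : ∀ w ∈ L, h w = w := fun w hw ↦
    hh w fun hw' ↦ connectedComponentIn_subset _ _ hw' hw
  have hsL : ∀ w ∈ L, h.symm w = w := fun w hw ↦ by
    rw [Homeomorph.symm_apply_eq, hhL w hw]
  have hvL : v ∈ L := Or.inl (mem_closedBall_self hr.le)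
  have hR0 : 0 < R := by simpa using hR hvL
  have hrR : r < R := by
    have := hR (Or.inl hpr : v + r ∈ L)
    rwa [mem_ball, dist_eq_norm, add_sub_cancel_left, hr1] at this
  -- The half plane `H` parametrises the punctured disc of radius `R` around `v`.
  let H : Set ℂ := {s | s.re < Real.log R}
  have hHn : ∀ s, s ∈ H ↔ ‖Complex.exp s‖ < R := fun s ↦ by
    rw [Complex.norm_exp]
    exact Real.lt_log_iff_exp_lt hR0
  have hHc : Convex ℝ H := convex_halfSpace_re_lt _
  have hHo : IsOpen H := isOpen_lt Complex.continuous_re continuous_const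
  have hHS : ∀ s ∈ H, h.symm (v + Complex.exp s) ∈ ({v, b}ᶜ : Set ℂ) := by
    rintro s hs (h0 | h0)
    · rw [Homeomorph.symm_apply_eq, hhL v hvL] at h0
      simp at h0
    · rw [mem_singleton_iff, Homeomorph.symm_apply_eq, hhb] at h0
      have := (hHn s).1 hs
      rw [← h0, add_sub_cancel_left] at hb'R
      linarith
  have hexp : Complex.exp (Real.log r) = r := by
    rw [← Complex.ofReal_exp, Real.exp_log hr]
  have hs₀ : ((Real.log r : ℝ) : ℂ) ∈ H := by
    rwa [hHn, hexp, hr1]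
  obtain ⟨ψ, hψc, hψ0, hψ⟩ := hcov.exists_continuousOn_lift hHo
    (hHc.isSimplyConnected ⟨_, hs₀⟩) (g := fun s ↦ h.symm (v + Complex.exp s))
    (by fun_prop) hHS hs₀ (e₀ := e.symm (v + r)) (by
      rw [hexp, hσ _ hpr, hsL _ (Or.inl hpr)])
  -- Near `v` the lift is given by the local inverse, hence it is periodic there.
  have hloc : EqOn ψ (fun s ↦ e.symm (v + Complex.exp s)) {s | s.re ≤ Real.log r} := by
    have hball : ∀ s ∈ {s : ℂ | s.re ≤ Real.log r}, v + Complex.exp s ∈ closedBall v r := by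
      intro s hs
      rw [mem_closedBall, dist_eq_norm, add_sub_cancel_left, Complex.norm_exp]
      exact (Real.le_log_iff_exp_le hr).1 hs
    have hsub : {s : ℂ | s.re ≤ Real.log r} ⊆ H := fun s hs ↦
      lt_of_le_of_lt hs (Real.log_lt_log hr hrR)
    refine hcov.eqOn_of_comp_eqOn (convex_halfSpace_re_le _).isPreconnected (hψc.mono hsub)
      (e.continuousOn_symm.comp (by fun_prop) fun s hs ↦ (hrV (hball s hs)).2.1) (fun s hs ↦ ?_)
      (fun s hs ↦ ?_) (a := (Real.log r : ℝ)) (by simp) (by rw [hψ0, hexp])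
    · simp only [Function.comp_apply, hψ s (hsub hs), hσ _ (hball s hs),
        hsL _ (Or.inl (hball s hs))]
    · rw [hψ s (hsub hs)]
      exact hHS s (hsub hs)
  have hτL : ∀ t, h (Q.eval (τ t)) = Q.eval (τ t) := fun t ↦ hhL _ (Or.inr ⟨t, rfl⟩)
  obtain ⟨s₁, hs₁, hz₁⟩ := hcov.exists_exp_eq_and_lift_eq Q.continuous (k := h.symm) hHS hψc hψ τ
    (fun t s hs ↦ by
      rw [hHn, hs, Homeomorph.symm_symm, hτL t, ← dist_eq_norm]
      exact hR (Or.inr ⟨t, rfl⟩))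
    (fun t ↦ by
      rw [Homeomorph.symm_symm, hτL t]
      exact (hτ t).2)
    (s₀ := (Real.log r : ℝ)) (by
      rw [hexp, hσ _ hpr, Homeomorph.symm_symm, hhL _ (Or.inl hpr), add_sub_cancel_left]) hψ0
  rw [hzp, Homeomorph.symm_symm, hhL _ (Or.inl hpr), add_sub_cancel_left] at hs₁
  have hψ₁ : ψ s₁ = e.symm (v + Complex.exp s₁) := hloc (show s₁.re ≤ Real.log r by
    rw [← Real.log_exp s₁.re, ← Complex.norm_exp, hs₁, hr1])
  rw [← hz₁, hψ₁, hs₁]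

/-- If `U` is simply connected and contains no critical value of `Q`, then `Q` is injective on
every connected set `K ⊆ U` with `Q(K) ⊆ U`: over `U` there is a section of `Q` through each point
of `K`, and it inverts `Q` on all of `K`. -/
theorem injOn_of_isPreconnected_of_mapsTo {Q : Polynomial ℂ} {S : Set ℂ}
    (hcov : IsCoveringMapOn (fun z ↦ Q.eval z) S) {U K : Set ℂ}
    (hU : IsOpen U) (hUs : IsSimplyConnected U) (hUS : U ⊆ S) (hK : IsPreconnected K)
    (hKU : ∀ z ∈ K, Q.eval z ∈ U) : InjOn (fun z ↦ Q.eval z) K := by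
  intro z₁ h₁ z₂ h₂ h₁₂
  obtain ⟨σ, hσc, hσ0, hσ⟩ := hcov.exists_continuousOn_lift hU hUs (g := id) continuousOn_id
    (fun s hs ↦ hUS hs) (hKU z₁ h₁) (e₀ := z₁) rfl
  have key : EqOn (fun z ↦ σ (Q.eval z)) id K :=
    hcov.eqOn_of_comp_eqOn hK (hσc.comp Q.continuous.continuousOn hKU) continuousOn_id
      (fun z hz ↦ by simpa using hσ _ (hKU z hz))
      (fun z hz ↦ by rw [hσ _ (hKU z hz)]; exact hUS (hKU z hz)) h₁ hσ0
  have h2 : σ (Q.eval z₂) = z₂ := key h₂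
  rw [← h2, ← show Q.eval z₁ = Q.eval z₂ from h₁₂, hσ0]

end Polynomial

/-! ### Polynomial-like maps and iterates -/

/-- The source of a polynomial-like map absorbs every connected subset of the preimage of the
target which it meets: by properness it is relatively closed in that preimage. -/
theorem IsPolynomialLike.subset_of_isPreconnected {f : ℂ → ℂ} {U V : Set ℂ} {d : ℕ}
    (h : IsPolynomialLike f U V d) (hf : Continuous f) {T : Set ℂ} (hT : IsPreconnected T)
    (hTV : ∀ z ∈ T, f z ∈ V) (hTU : (T ∩ U).Nonempty) : T ⊆ U := by
  refine hT.subset_of_closure_inter_subset h.jordan_source.isOpen hTU ?_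
  rintro z ⟨hzU, hzT⟩
  obtain ⟨hm, hp⟩ := h.proper
  have hne : (Filter.comap ((↑) : U → ℂ) (𝓝 z)).NeBot := by
    rwa [← mem_closure_iff_comap_neBot]
  have ht : Filter.Tendsto (hm.restrict f U V) (Filter.comap ((↑) : U → ℂ) (𝓝 z))
      (𝓝 ⟨f z, hTV z hzT⟩) := by
    rw [tendsto_subtype_rng]
    exact hf.continuousAt.tendsto.comp Filter.tendsto_comap
  obtain ⟨x, -, hx⟩ := ((isProperMap_iff_clusterPt _).1 hp).2 ht.mapClusterPt
  have hxz : ClusterPt (x : ℂ) (𝓝 z) := hx.map continuous_subtype_val.continuousAt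
    Filter.tendsto_comap
  have : (x : ℂ) = z := by
    have := hxz
    rw [ClusterPt] at this
    exact eq_of_nhds_neBot this
  exact this ▸ x.2

/-- Over a regular value, the degree counts the points of the fibre. -/
theorem IsPolynomialLike.ncard_fiber_eq {Q : Polynomial ℂ} {U V : Set ℂ} {d : ℕ}
    (h : IsPolynomialLike (fun z ↦ Q.eval z) U V d) {p : ℂ} (hp : p ∈ V)
    (hreg : ∀ z, Q.eval z = p → Q.derivative.eval z ≠ 0) :
    (U ∩ (fun z ↦ Q.eval z) ⁻¹' {p}).ncard = d := by
  rw [← h.degree_eq p hp, ← finsum_one]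
  refine finsum_mem_congr rfl fun z hz ↦ ?_
  have hz' : Q.eval z = p := hz.2
  have hA : AnalyticAt ℂ (fun z ↦ Q.eval z) z :=
    (Q.differentiable.analyticAt z)
  have := hA.analyticOrderAt_sub_eq_one_of_deriv_ne_zero (by
    rw [Q.deriv]
    exact hreg z hz')
  rw [hz'] at this
  rw [analyticOrderNatAt, this]
  rfl

namespace Polynomial

theorem ncard_preimage_eval_singleton {Q : Polynomial ℂ} {p : ℂ} (hQ : Q.natDegree ≠ 0)
    (hreg : ∀ z, Q.eval z = p → Q.derivative.eval z ≠ 0) :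
    ((fun z ↦ Q.eval z) ⁻¹' {p}).ncard = Q.natDegree := by
  have hne : Q - C p ≠ 0 := fun h ↦ hQ (by rw [sub_eq_zero.1 h, natDegree_C])
  have hset : (fun z ↦ Q.eval z) ⁻¹' {p} = ((Q - C p).roots.toFinset : Set ℂ) := by
    ext z
    simp [hne, sub_eq_zero]
  have hnd : (Q - C p).roots.Nodup := by
    rw [Multiset.nodup_iff_count_le_one]
    intro z
    rw [count_roots]
    by_contra! h
    rw [one_lt_rootMultiplicity_iff_isRoot hne] at h
    exact hreg z (by simpa [sub_eq_zero] using h.1) (by simpa using h.2)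
  rw [hset, ncard_coe_finset, Multiset.toFinset_card_of_nodup hnd,
    IsAlgClosed.card_roots_eq_natDegree, natDegree_sub_C]

/-- The orbit of a critical point of the `n`-th iterate meets the critical points in time less
than `n`. -/
theorem exists_iterate_mem_finiteCriticalPoints {P : Polynomial ℂ} {n : ℕ} {z : ℂ}
    (h : (derivative (P.comp^[n] X)).eval z = 0) :
    ∃ j < n, (fun z ↦ P.eval z)^[j] z ∈ P.finiteCriticalPoints := by
  induction n with
  | zero => simp at h
  | succ n ih =>
    rw [Function.iterate_succ_apply', derivative_comp, eval_mul, eval_comp, iterate_comp_eval,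
      eval_X, mul_eq_zero] at h
    rcases h with h | h
    · obtain ⟨j, hj, hj'⟩ := ih h
      exact ⟨j, hj.trans n.lt_succ_self, hj'⟩
    · exact ⟨n, n.lt_succ_self, h⟩

theorem iterate_mem_finitePostcriticalSet {P : Polynomial ℂ} {w : ℂ}
    (hw : w ∈ P.finitePostcriticalSet) (n : ℕ) :
    (fun z ↦ P.eval z)^[n] w ∈ P.finitePostcriticalSet := by
  obtain ⟨k, hk, c, hc, rfl⟩ := hw
  exact ⟨n + k, by omega, c, hc, Function.iterate_add_apply ..⟩

end Polynomial

/-! ### Non-renormalizability -/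

open Polynomial in
theorem theorem10p3 (P : Polynomial ℂ)
    (hpost : P.finitePostcriticalSet.ncard = 2)
    (hper : ∀ c ∈ P.finiteCriticalPoints, c ∉ Function.periodicPts (fun z => P.eval z)) :
    ¬ P.IsRenormalizable := by
  rintro ⟨n, hn, U, V, δ, hpl, hK, hδ2, hδ⟩
  set Q : Polynomial ℂ := P.comp^[n] X
  have hQe : (fun z ↦ P.eval z)^[n] = fun z ↦ Q.eval z := by
    funext z
    rw [iterate_comp_eval, eval_X]
  have hQd : Q.natDegree = P.natDegree ^ n := by
    rw [natDegree_iterate_comp, natDegree_X, mul_one]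
  rw [hQe] at hpl hK
  rw [← hQd] at hδ
  have hQ0 : Q.natDegree ≠ 0 := by omega
  have hUV : ∀ z ∈ U, Q.eval z ∈ V := fun z hz ↦ hpl.proper.choose hz
  have hUV' : U ⊆ V := subset_closure.trans hpl.closure_subset
  have hcritS : ∀ z, Q.derivative.eval z = 0 → Q.eval z ∈ P.finitePostcriticalSet := by
    intro z hz
    obtain ⟨j, hj, hjc⟩ := exists_iterate_mem_finiteCriticalPoints hz
    refine ⟨n - j, by omega, _, hjc, ?_⟩
    rw [← Function.iterate_add_apply, Nat.sub_add_cancel hj.le, hQe]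
  have hQS : ∀ w ∈ P.finitePostcriticalSet, Q.eval w ∈ P.finitePostcriticalSet := by
    intro w hw
    rw [← show (fun z ↦ P.eval z)^[n] w = Q.eval w from congr_fun hQe w]
    exact iterate_mem_finitePostcriticalSet hw n
  have hfix : ∀ v, Q.eval v = v → Q.derivative.eval v ≠ 0 := by
    intro v hv hv'
    obtain ⟨j, -, hjc⟩ := exists_iterate_mem_finiteCriticalPoints hv'
    refine hper _ hjc (Function.mk_mem_periodicPts hn ?_)
    have : Function.IsPeriodicPt (fun z ↦ P.eval z) n v := (congr_fun hQe v).trans hv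
    exact this.apply_iterate j
  obtain ⟨a, b, hab, hS⟩ := ncard_eq_two.1 hpost
  rw [hS] at hcritS hQS
  have hreg : ∀ p, p ≠ a → p ≠ b → ∀ z, Q.eval z = p → Q.derivative.eval z ≠ 0 := by
    rintro p hpa hpb z rfl hz
    exact (hcritS z hz).elim hpa hpb
  by_cases hcase : a ∈ V ∧ b ∈ V
  · -- Both postcritical points lie in `V`, so `U` is the full preimage of `V`.
    obtain ⟨p, hp, hpa, hpb, hfull⟩ := exists_fiber_subset_of_mem_mem hQ0 hcritS
      hpl.jordan_target.isOpen hpl.jordan_target.isSimplyConnected.isPathConnected.isConnected.2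
      hcase.1 hcase.2 hab (fun T ↦ hpl.subset_of_isPreconnected Q.continuous)
    have hcard := hpl.ncard_fiber_eq hp (hreg p hpa hpb)
    obtain ⟨u, hu, hup⟩ := nonempty_of_ncard_ne_zero (hcard.trans_ne (by omega))
    rw [inter_eq_right.2 (show (fun z ↦ Q.eval z) ⁻¹' {p} ⊆ U from hfull u hu hup),
      ncard_preimage_eval_singleton hQ0 (hreg p hpa hpb)] at hcard
    omega
  · obtain ⟨v, b, hb, hcrit, hvS, hreg⟩ : ∃ v b : ℂ, b ∉ V ∧
        (∀ z, Q.derivative.eval z = 0 → Q.eval z = v ∨ Q.eval z = b) ∧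
        (Q.eval v = v ∨ Q.eval v = b) ∧
        (∀ p, p ≠ v → p ≠ b → ∀ z, Q.eval z = p → Q.derivative.eval z ≠ 0) := by
      rcases not_and_or.1 hcase with h | h
      · exact ⟨b, a, h, fun z hz ↦ (hcritS z hz).symm, (hQS b (by simp)).symm,
          fun p h₁ h₂ ↦ hreg p h₂ h₁⟩
      · exact ⟨a, b, h, hcritS, hQS a (by simp), hreg⟩
    by_cases hvU : v ∈ U
    · -- The point `v` is fixed by `Q` and not critical, as no critical point of `P` is periodic.
      have hQv : Q.eval v = v := hvS.resolve_right fun h ↦ hb (h ▸ hUV v hvU)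
      obtain ⟨p, hp, hpv, hpb, hinj⟩ := exists_fiber_subsingleton_of_notMem hcrit hQ0
        hpl.jordan_target.isOpen hpl.jordan_target.isSimplyConnected hb hpl.jordan_source.isOpen
        hpl.jordan_source.isSimplyConnected.isPathConnected.isConnected.2 hUV hvU hQv (hfix v hQv)
      have hcard := hpl.ncard_fiber_eq hp (hreg p hpv hpb)
      have hle := (ncard_le_one (finite_of_ncard_ne_zero (hcard.trans_ne (by omega)))).2
        fun z₁ h₁ z₂ h₂ ↦ hinj z₁ h₁.1 z₂ h₂.1 h₁.2 h₂.2
      omega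
    · -- There is no critical value in `U`, and the fibre in `U` of a point `k` of the filled Julia
      -- set lies in the filled Julia set, on which `Q` is injective.
      have hbU : b ∉ U := fun h ↦ hb (hUV' h)
      obtain ⟨⟨k, hk⟩, hKc⟩ := hK
      have hKU : ∀ z ∈ filledJuliaSet (fun z ↦ Q.eval z) U, Q.eval z ∈ U := fun z hz ↦ hz 1
      have hinj := injOn_of_isPreconnected_of_mapsTo (isCoveringMapOn_eval_compl_pair hcrit)
        hpl.jordan_source.isOpen hpl.jordan_source.isSimplyConnected
        (by
          rintro z hz (rfl | rfl)
          exacts [hvU hz, hbU hz]) hKc hKU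
      have hkU : k ∈ U := hk 0
      have hfib : ∀ z ∈ U, Q.eval z = k → z ∈ filledJuliaSet (fun z ↦ Q.eval z) U := by
        rintro z hz rfl (_ | j)
        exacts [hz, hk j]
      have hcard := hpl.ncard_fiber_eq (hUV' hkU)
        (hreg k (fun h ↦ hvU (h ▸ hkU)) (fun h ↦ hbU (h ▸ hkU)))
      have hle := (ncard_le_one (finite_of_ncard_ne_zero (hcard.trans_ne (by omega)))).2
        fun z₁ h₁ z₂ h₂ ↦ hinj (hfib z₁ h₁.1 h₁.2) (hfib z₂ h₂.1 h₂.2)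
          ((show Q.eval z₁ = k from h₁.2).trans (show Q.eval z₂ = k from h₂.2).symm)
      omega
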